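/- **Setting.** Let $\mathcal A$ and $\mathcal B$ be finite action sets. An instance $\mathcal I=(\mathcal A,\mathcal B,v_1,v_2)$ consists of mean rewards $v_1,v_2:\mathcal A\times\mathcal B\to[0,1]$ of the leader (Player 1) and the follower (Player 2). In each round $t=1,\dots,T$ the leader draws $a_t\in\mathcal A$ from a distribution chosen by its algorithm $\mathrm{ALG}_1$ as a function of its history, the follower then sees $a_t$ and draws $b_t\in\mathcal B$ from a distribution chosen by its algorithm $\mathrm{ALG}_2$ as a function of $a_t$ and its history, and the players receive independent rewards $r_{1,t}\sim N(v_1(a_t,b_t),1)$ and $r_{2,t}\sim N(v_2(a_t,b_t),1)$. The follower's history consists of the past triples $(a_s,b_s,r_{2,s})$. The leader's history consists of the past pairs $(a_s,r_{1,s})$ in a strongly decentralized Stackelberg game (StrongDSG), and of the past triples $(a_s,b_s,r_{1,s})$ in a weakly decentralized one (WeakDSG). For $\varepsilon\ge 0$ put $$\mathcal B_\varepsilon(a)=\{b: v_2(a,b)\ge \max_{b'\in\mathcal B} v_2(a,b')-\varepsilon\},\qquad \mathcal A_\varepsilon=\{a:\max_{b\in\mathcal B_\varepsilon(a)}v_1(a,b)\ge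 \max_{a'\in\mathcal A}\min_{b'\in\mathcal B_\varepsilon(a')}v_1(a',b')-\varepsilon\}.$$ For a maximum tolerance $\gamma>0$ the $\gamma$-tolerant benchmarks are $$\beta_1^\gamma=\inf_{0\le\varepsilon\le\gamma}\Big(\max_{a\in\mathcal A}\min_{b\in\mathcal B_\varepsilon(a)}v_1(a,b)+\varepsilon\Big),\qquad \beta_2^\gamma=\inf_{0\le\varepsilon\le\gamma}\Big(\min_{a\in\mathcal A_\varepsilon}\max_{b\in\mathcal B}v_2(a,b)+\varepsilon\Big),$$ and the regret of Player $i$ is $R_i^\gamma(T;\mathcal I)=\beta_i^\gamma\, T-\sum_{t=1}^T\mathbb E[r_{i,t}]$. **Theorem.** There is an absolute constant $c>0$ such that the following holds for all finite sets $\mathcal A,\mathcal B$ with $|\mathcal A|\ge2$ and $|\mathcal B|\ge2$ and every horizon $T\ge|\mathcal B|$, both for StrongDSGs and for WeakDSGs. For any algorithms $\mathrm{ALG}_1$ and $\mathrm{ALG}_2$ (which may depend on $T$) there is an instance $\mathcal I^*=(\mathcal A,\mathcal B,v_1,v_2)$ such that for every $\gamma\in(0,1]$ at least one of the players incurs $\Omega(T^{2/3}|\mathcal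 B|^{1/3})$ regret with respect to the $\gamma$-tolerant benchmarks: $$\max\big(R_1^\gamma(T;\mathcal I^*),R_2^\gamma(T;\mathcal I^*)\big)\ \ge\ c\;T^{2/3}\,|\mathcal B|^{1/3}.$$ -/

import Mathlib

open MeasureTheory ProbabilityTheory

noncomputable section

namespace StackelbergGame

/-! ### The static game and the tolerant benchmarks -/

/-- An instance on the action sets `A` (leader, Player 1) and `B` (follower, Player 2):
the mean rewards of the two players, with values in `[0, 1]`. -/
structure GameInstance (A B : Type*) where
  /-- mean reward of the leader -/
  v₁ : A → B → ℝ
  /-- mean reward of the follower -/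
  v₂ : A → B → ℝ
  v₁_mem : ∀ a b, v₁ a b ∈ Set.Icc (0 : ℝ) 1
  v₂_mem : ∀ a b, v₂ a b ∈ Set.Icc (0 : ℝ) 1

namespace GameInstance

variable {A B : Type*} (I : GameInstance A B)

/-- The follower's `ε`-best-response set to the leader's action `a`. -/
def followerBR (ε : ℝ) (a : A) : Set B :=
  {b | (⨆ b' : B, I.v₂ a b') - ε ≤ I.v₂ a b}

/-- The leader's `ε`-relaxed Stackelberg utility `max_a min_{b ∈ B_ε(a)} v₁(a, b)`. -/
def leaderRelaxed (ε : ℝ) : ℝ :=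
  ⨆ a : A, ⨅ b : I.followerBR ε a, I.v₁ a b

/-- The leader's `ε`-best-response set. -/
def leaderBR (ε : ℝ) : Set A :=
  {a | I.leaderRelaxed ε - ε ≤ ⨆ b : I.followerBR ε a, I.v₁ a b}

/-- The follower's `ε`-relaxed Stackelberg utility `min_{a ∈ A_ε} max_b v₂(a, b)`. -/
def followerRelaxed (ε : ℝ) : ℝ :=
  ⨅ a : I.leaderBR ε, ⨆ b : B, I.v₂ a b

/-- The leader's `γ`-tolerant benchmark. -/
def leaderBenchmark (γ : ℝ) : ℝ :=
  ⨅ ε : Set.Icc (0 : ℝ) γ, (I.leaderRelaxed ε + ε)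

/-- The follower's `γ`-tolerant benchmark. -/
def followerBenchmark (γ : ℝ) : ℝ :=
  ⨅ ε : Set.Icc (0 : ℝ) γ, (I.followerRelaxed ε + ε)

/-- For `ε ≥ 0` the minima over the follower's `ε`-best-response sets are over nonempty sets. -/
theorem followerBR_nonempty [Finite B] [Nonempty B] {ε : ℝ} (hε : 0 ≤ ε) (a : A) :
    (I.followerBR ε a).Nonempty := by
  obtain ⟨b, hb⟩ := exists_eq_ciSup_of_finite (f := fun b' : B => I.v₂ a b')
  refine ⟨b, ?_⟩
  simp only [followerBR, Set.mem_ofPred_eq, ← hb]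
  linarith

/-- For `ε ≥ 0` the minimum over the leader's `ε`-best-response set is over a nonempty set. -/
theorem leaderBR_nonempty [Finite A] [Nonempty A] [Finite B] [Nonempty B] {ε : ℝ} (hε : 0 ≤ ε) :
    (I.leaderBR ε).Nonempty := by
  obtain ⟨a, ha⟩ := exists_eq_ciSup_of_finite (f := fun a : A => ⨅ b : I.followerBR ε a, I.v₁ a b)
  have : Nonempty (I.followerBR ε a) := (I.followerBR_nonempty hε a).to_subtype
  refine ⟨a, ?_⟩
  have h : (⨅ b : I.followerBR ε a, I.v₁ a b) ≤ ⨆ b : I.followerBR ε a, I.v₁ a b :=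
    ciInf_le_ciSup (Set.finite_range _).bddBelow (Set.finite_range _).bddAbove
  simp only [leaderBR, leaderRelaxed, Set.mem_ofPred_eq, ← ha]
  linarith

end GameInstance

/-! ### Histories, information structures and algorithms -/

/-- The outcome `((a, b), (r₁, r₂))` of one round: the two actions and the two rewards. -/
abbrev Round (A B : Type*) := (A × B) × (ℝ × ℝ)

section Model

variable {A B O : Type*}

/-- What the leader sees of a round in a strongly decentralized game: its own action and its own
reward. -/
def strongObs (x : Round A B) : A × ℝ := (x.1.1, x.2.1)

/-- What the leader sees of a round in a weakly decentralized game: both actions and its own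
reward. -/
def weakObs (x : Round A B) : (A × B) × ℝ := (x.1, x.2.1)

/-- What the follower sees of a round: both actions and its own reward. -/
def followerObs (x : Round A B) : (A × B) × ℝ := (x.1, x.2.2)

variable [MeasurableSpace A] [MeasurableSpace B] [MeasurableSpace O]

theorem measurable_strongObs : Measurable (strongObs : Round A B → A × ℝ) := by
  unfold strongObs; fun_prop

theorem measurable_weakObs : Measurable (weakObs : Round A B → (A × B) × ℝ) := by
  unfold weakObs; fun_prop

theorem measurable_followerObs : Measurable (followerObs : Round A B → (A × B) × ℝ) := by
  unfold followerObs; fun_prop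

/-- Appending one round to a history is measurable. -/
theorem measurable_snoc (t : ℕ) : Measurable fun p : (Fin t → Round A B) × Round A B =>
    (Fin.snoc (α := fun _ => Round A B) p.1 p.2 : Fin (t + 1) → Round A B) := by
  refine measurable_pi_lambda _ fun i => ?_
  refine Fin.lastCases ?_ (fun j => ?_) i
  · simpa using measurable_snd
  · simp only [Fin.snoc_castSucc]; fun_prop

/-- A leader algorithm whose observation in each round lies in `O`: after `t` rounds it maps the
history of the `t` observations to a distribution over the leader's actions. -/
structure LeaderAlg (O A : Type*) [MeasurableSpace O] [MeasurableSpace A] where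
  act : (t : ℕ) → Kernel (Fin t → O) A
  isMarkov : ∀ t, IsMarkovKernel (act t)

/-- A follower algorithm: after `t` rounds it maps the leader's current action and the history of
the follower's `t` observations to a distribution over the follower's actions. -/
structure FollowerAlg (A B : Type*) [MeasurableSpace A] [MeasurableSpace B] where
  act : (t : ℕ) → Kernel (A × (Fin t → (A × B) × ℝ)) B
  isMarkov : ∀ t, IsMarkovKernel (act t)

instance (L : LeaderAlg O A) (t : ℕ) : IsMarkovKernel (L.act t) := L.isMarkov t

instance (F : FollowerAlg A B) (t : ℕ) : IsMarkovKernel (F.act t) := F.isMarkov t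

/-! ### The law of the interaction -/

variable [Finite A] [MeasurableSingletonClass A] [Finite B] [MeasurableSingletonClass B]

/-- Given the actions `(a, b)`, the two rewards are independent with laws `N(v₁(a, b), 1)` and
`N(v₂(a, b), 1)`. -/
def rewardKernel (I : GameInstance A B) : Kernel (A × B) (ℝ × ℝ) :=
  Kernel.ofFunOfCountable fun p =>
    (gaussianReal (I.v₁ p.1 p.2) 1).prod (gaussianReal (I.v₂ p.1 p.2) 1)

instance (I : GameInstance A B) : IsMarkovKernel (rewardKernel I) :=
  ⟨fun p => inferInstanceAs (IsProbabilityMeasure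
    ((gaussianReal (I.v₁ p.1 p.2) 1).prod (gaussianReal (I.v₂ p.1 p.2) 1)))⟩

/-- The conditional law of the leader's next action given the first `t` rounds. -/
def leaderKernel (L : LeaderAlg O A) (obs : Round A B → O) (hobs : Measurable obs) (t : ℕ) :
    Kernel (Fin t → Round A B) A :=
  (L.act t).comap (fun h s => obs (h s)) (by fun_prop)

/-- The conditional law of the follower's next action given the first `t` rounds and the leader's
next action. -/
def followerKernel (F : FollowerAlg A B) (t : ℕ) :
    Kernel ((Fin t → Round A B) × A) B :=
  (F.act t).comap (fun p => (p.2, fun s => followerObs (p.1 s)))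
    (by have := measurable_followerObs (A := A) (B := B); fun_prop)

/-- The conditional law of the next round given the first `t` rounds. -/
def roundKernel (I : GameInstance A B) (L : LeaderAlg O A) (obs : Round A B → O)
    (hobs : Measurable obs) (F : FollowerAlg A B) (t : ℕ) :
    Kernel (Fin t → Round A B) (Round A B) :=
  (leaderKernel L obs hobs t ⊗ₖ followerKernel F t) ⊗ₖ
    (rewardKernel I).comap Prod.snd measurable_snd

/-- The law of the first `T` rounds of the interaction. -/
def law (I : GameInstance A B) (L : LeaderAlg O A) (obs : Round A B → O) (hobs : Measurable obs)
    (F : FollowerAlg A B) : (T : ℕ) → Measure (Fin T → Round A B)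
  | 0 => Measure.dirac Fin.elim0
  | T + 1 => (law I L obs hobs F T ⊗ₘ roundKernel I L obs hobs F T).map
      fun p => Fin.snoc (α := fun _ => Round A B) p.1 p.2

instance (I : GameInstance A B) (L : LeaderAlg O A) (obs : Round A B → O) (hobs : Measurable obs)
    (F : FollowerAlg A B) (t : ℕ) : IsMarkovKernel (roundKernel I L obs hobs F t) := by
  unfold roundKernel leaderKernel followerKernel; infer_instance

/-- The law of the interaction is a probability measure. -/
instance (I : GameInstance A B) (L : LeaderAlg O A) (obs : Round A B → O) (hobs : Measurable obs)
    (F : FollowerAlg A B) (T : ℕ) : IsProbabilityMeasure (law I L obs hobs F T) := by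
  induction T with
  | zero => unfold law; infer_instance
  | succ T ih => unfold law; exact Measure.isProbabilityMeasure_map (measurable_snoc T).aemeasurable

/-! ### Regret -/

/-- The leader's expected regret over `T` rounds with respect to its `γ`-tolerant benchmark. -/
def leaderRegret (γ : ℝ) (I : GameInstance A B) (L : LeaderAlg O A) (obs : Round A B → O)
    (hobs : Measurable obs) (F : FollowerAlg A B) (T : ℕ) : ℝ :=
  I.leaderBenchmark γ * T - ∑ t : Fin T, ∫ h, (h t).2.1 ∂(law I L obs hobs F T)

/-- The follower's expected regret over `T` rounds with respect to its `γ`-tolerant benchmark. -/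
def followerRegret (γ : ℝ) (I : GameInstance A B) (L : LeaderAlg O A) (obs : Round A B → O)
    (hobs : Measurable obs) (F : FollowerAlg A B) (T : ℕ) : ℝ :=
  I.followerBenchmark γ * T - ∑ t : Fin T, ∫ h, (h t).2.2 ∂(law I L obs hobs F T)

end Model

end StackelbergGame

end

/-!
The leader owns safe actions and one risky action `a₂`. On `a₂` it gains a margin `δ` over the safe
actions if the follower answers `b₀`, and loses a constant otherwise; the follower always earns least
on `a₂`. In the base instance `b₀` is the follower's best answer to `a₂`, and the leader's benchmark
asks for `a₂` to be played: a safe round costs the leader `δ`, and a round in which another response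
is tried on `a₂` costs it a constant (`leaderRegret_hardInstance_ge`). In a perturbed instance one
hidden response `j ≠ b₀` to `a₂` pays the follower more by `δ` than `b₀`. The leader should then stay
away from `a₂`, and every round on `a₂` costs the follower `δ` (`followerRegret_hardInstance_ge`).
The margins are chosen so that a tolerance `ε < δ` leaves the best answer to `a₂` unique, while a
tolerance `ε ≥ δ` adds to
the benchmarks at least what it takes away from them. Hence the two bounds on the benchmarks hold
for every `γ ≥ 0`.

If the leader's regret in the base instance is at most `R`, then `a₂` is played in all but `R / δ`
rounds, and some `j ≠ b₀` is tried on `a₂` in only `O(R / |B|)` rounds. The perturbed instance with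
this `j` differs from the base instance only in the law of the follower's reward for `(a₂, j)`, so
that the relative entropy of the two laws of the interaction is `O(δ ^ 2 R / |B|)`
(`law_eq_withDensity`, `integral_logLik`). With `δ` of order `(|B| / T) ^ (1 / 3)` and `R` a small
multiple of `T ^ (2 / 3) * |B| ^ (1 / 3)` it is a small constant, so `a₂` is still played in at least
half of the rounds (`expectedTotal_change`), and the follower's regret is of order `δ T`. What the
leader observes plays no role, since the argument is about the joint law of all that happens.
-/

noncomputable section

namespace StackelbergGame

/-! ### Integration against the law of the interaction -/

section Law

variable {A B O : Type*} [MeasurableSpace A] [MeasurableSpace B] [MeasurableSpace O]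
  [Finite A] [MeasurableSingletonClass A] [Finite B] [MeasurableSingletonClass B]

/-- The conditional law of the next action pair given the first `t` rounds. It does not depend on
the instance, so two instances differ only through their reward kernels. -/
def actionKernel (L : LeaderAlg O A) (obs : Round A B → O) (hobs : Measurable obs)
    (F : FollowerAlg A B) (t : ℕ) : Kernel (Fin t → Round A B) (A × B) :=
  leaderKernel L obs hobs t ⊗ₖ followerKernel F t

instance (L : LeaderAlg O A) (obs : Round A B → O) (hobs : Measurable obs)
    (F : FollowerAlg A B) (t : ℕ) : IsMarkovKernel (actionKernel L obs hobs F t) := by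
  unfold actionKernel leaderKernel followerKernel; infer_instance

variable (I : GameInstance A B) (L : LeaderAlg O A) (obs : Round A B → O) (hobs : Measurable obs)
  (F : FollowerAlg A B)

theorem lintegral_roundKernel {t : ℕ} (h : Fin t → Round A B) {f : Round A B → ENNReal}
    (hf : Measurable f) :
    ∫⁻ x, f x ∂(roundKernel I L obs hobs F t h) =
      ∫⁻ p, ∫⁻ r, f (p, r) ∂(rewardKernel I p) ∂(actionKernel L obs hobs F t h) := by
  change ∫⁻ x, f x ∂((actionKernel L obs hobs F t ⊗ₖ
    (rewardKernel I).comap Prod.snd measurable_snd) h) = _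
  rw [Kernel.lintegral_compProd _ _ _ hf]
  rfl

theorem lintegral_law_succ (T : ℕ) {f : (Fin (T + 1) → Round A B) → ENNReal}
    (hf : Measurable f) :
    ∫⁻ h, f h ∂(law I L obs hobs F (T + 1)) =
      ∫⁻ h, ∫⁻ x, f (Fin.snoc (α := fun _ => Round A B) h x) ∂(roundKernel I L obs hobs F T h)
        ∂(law I L obs hobs F T) := by
  rw [law, lintegral_map hf (measurable_snoc T),
    Measure.lintegral_compProd (f := fun p => f (Fin.snoc (α := fun _ => Round A B) p.1 p.2))
      (hf.comp (measurable_snoc T))]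

theorem measurable_lintegral_rewardKernel {f : Round A B → ENNReal} (hf : Measurable f) :
    Measurable fun p : A × B => ∫⁻ r, f (p, r) ∂(rewardKernel I p) :=
  hf.lintegral_kernel_prod_right'

/-- Given the actions of a round, its rewards are distributed according to the reward kernel. -/
theorem lintegral_law_apply {T : ℕ} (t : Fin T) {f : Round A B → ENNReal} (hf : Measurable f) :
    ∫⁻ h, f (h t) ∂(law I L obs hobs F T) =
      ∫⁻ h, ∫⁻ r, f ((h t).1, r) ∂(rewardKernel I (h t).1) ∂(law I L obs hobs F T) := by
  have hg := measurable_lintegral_rewardKernel I hf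
  have hg' : Measurable fun x : Round A B => ∫⁻ r, f (x.1, r) ∂(rewardKernel I x.1) :=
    hg.comp measurable_fst
  induction T with
  | zero => exact t.elim0
  | succ T ih =>
    rw [lintegral_law_succ I L obs hobs F T (f := fun h => f (h t))
        (hf.comp (measurable_pi_apply t)),
      lintegral_law_succ I L obs hobs F T
        (f := fun h => ∫⁻ r, f ((h t).1, r) ∂(rewardKernel I (h t).1))
        (hg'.comp (measurable_pi_apply t))]
    induction t using Fin.lastCases with
    | last =>
      refine lintegral_congr fun h => ?_
      simp only [Fin.snoc_last]
      rw [lintegral_roundKernel I L obs hobs F h hf, lintegral_roundKernel I L obs hobs F h hg']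
      simp
    | cast s => simpa using ih s

/-- The law of round `t`, disintegrated over the action pair of that round. -/
theorem map_law_eq_compProd {T : ℕ} (t : Fin T) :
    (law I L obs hobs F T).map (fun h => h t) =
      ((law I L obs hobs F T).map fun h => (h t).1) ⊗ₘ rewardKernel I := by
  have h1 : Measurable fun h : Fin T → Round A B => (h t).1 := by fun_prop
  have := Measure.isProbabilityMeasure_map (μ := law I L obs hobs F T) h1.aemeasurable
  refine Measure.ext_of_lintegral _ fun f hf => ?_
  rw [lintegral_map hf (measurable_pi_apply t), lintegral_law_apply I L obs hobs F t hf,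
    Measure.lintegral_compProd hf, lintegral_map (measurable_lintegral_rewardKernel I hf) h1]

theorem integrable_law_apply {T : ℕ} (t : Fin T) {f : Round A B → ℝ} (hf : Measurable f)
    (hint : ∀ p, Integrable (fun r => f (p, r)) (rewardKernel I p)) :
    Integrable (fun h => f (h t)) (law I L obs hobs F T) := by
  have h1 : Measurable fun h : Fin T → Round A B => (h t).1 := by fun_prop
  have := Measure.isProbabilityMeasure_map (μ := law I L obs hobs F T) h1.aemeasurable
  have key : Integrable f ((law I L obs hobs F T).map fun h => h t) := by
    rw [map_law_eq_compProd, Measure.integrable_compProd_iff hf.aestronglyMeasurable]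
    exact ⟨.of_forall hint, .of_finite⟩
  exact key.comp_measurable (measurable_pi_apply t)

theorem integral_law_apply {T : ℕ} (t : Fin T) {f : Round A B → ℝ} (hf : Measurable f)
    (hint : ∀ p, Integrable (fun r => f (p, r)) (rewardKernel I p)) :
    ∫ h, f (h t) ∂(law I L obs hobs F T) =
      ∫ h, (∫ r, f ((h t).1, r) ∂(rewardKernel I (h t).1)) ∂(law I L obs hobs F T) := by
  have h1 : Measurable fun h : Fin T → Round A B => (h t).1 := by fun_prop
  have := Measure.isProbabilityMeasure_map (μ := law I L obs hobs F T) h1.aemeasurable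
  have key : Integrable f (((law I L obs hobs F T).map fun h => (h t).1) ⊗ₘ rewardKernel I) := by
    rw [Measure.integrable_compProd_iff hf.aestronglyMeasurable]
    exact ⟨.of_forall hint, .of_finite⟩
  rw [← integral_map (φ := fun h : Fin T → Round A B => h t) (f := f)
      (measurable_pi_apply t).aemeasurable hf.aestronglyMeasurable,
    map_law_eq_compProd, Measure.integral_compProd key,
    integral_map h1.aemeasurable (Measurable.of_discrete).aestronglyMeasurable]

theorem integrable_fst_rewardKernel (p : A × B) :
    Integrable (fun r : ℝ × ℝ => r.1) (rewardKernel I p) :=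
  ((memLp_id_gaussianReal (μ := I.v₁ p.1 p.2) (v := 1) 1).integrable (by simp)).comp_fst _

theorem integrable_snd_rewardKernel (p : A × B) :
    Integrable (fun r : ℝ × ℝ => r.2) (rewardKernel I p) :=
  ((memLp_id_gaussianReal (μ := I.v₂ p.1 p.2) (v := 1) 1).integrable (by simp)).comp_snd _

theorem integral_fst_rewardKernel (p : A × B) :
    ∫ r : ℝ × ℝ, r.1 ∂(rewardKernel I p) = I.v₁ p.1 p.2 := by
  change ∫ r : ℝ × ℝ, r.1 ∂((gaussianReal (I.v₁ p.1 p.2) 1).prod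
    (gaussianReal (I.v₂ p.1 p.2) 1)) = _
  rw [integral_fun_fst (fun x : ℝ => x)]
  simp

theorem integral_snd_rewardKernel (p : A × B) :
    ∫ r : ℝ × ℝ, r.2 ∂(rewardKernel I p) = I.v₂ p.1 p.2 := by
  change ∫ r : ℝ × ℝ, r.2 ∂((gaussianReal (I.v₁ p.1 p.2) 1).prod
    (gaussianReal (I.v₂ p.1 p.2) 1)) = _
  rw [integral_fun_snd (fun x : ℝ => x)]
  simp

theorem integral_leader_reward {T : ℕ} (t : Fin T) :
    ∫ h, (h t).2.1 ∂(law I L obs hobs F T) =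
      ∫ h, I.v₁ (h t).1.1 (h t).1.2 ∂(law I L obs hobs F T) := by
  rw [integral_law_apply I L obs hobs F t (f := fun x => x.2.1) (by fun_prop)
    (integrable_fst_rewardKernel I)]
  simp only [integral_fst_rewardKernel]

theorem integral_follower_reward {T : ℕ} (t : Fin T) :
    ∫ h, (h t).2.2 ∂(law I L obs hobs F T) =
      ∫ h, I.v₂ (h t).1.1 (h t).1.2 ∂(law I L obs hobs F T) := by
  rw [integral_law_apply I L obs hobs F t (f := fun x => x.2.2) (by fun_prop)
    (integrable_snd_rewardKernel I)]
  simp only [integral_snd_rewardKernel]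

/-- Every function of the action pair of a round is integrable: it takes finitely many values. -/
theorem integrable_law_action {T : ℕ} (t : Fin T) (g : A × B → ℝ) :
    Integrable (fun h => g (h t).1) (law I L obs hobs F T) :=
  integrable_law_apply I L obs hobs F t (f := fun x => g x.1)
    ((Measurable.of_discrete (f := g)).comp measurable_fst) fun p => integrable_const (g p)

end Law

/-! ### Change of measure between two instances -/

section ChangeOfMeasure

/-- The Gaussian change of mean: the density of `N(m', 1)` with respect to `N(m, 1)`. -/
theorem gaussianReal_eq_withDensity (m m' : ℝ) :
    gaussianReal m' 1 = (gaussianReal m 1).withDensity fun x =>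
      ENNReal.ofReal (Real.exp ((m' - m) * (x - m) - (m' - m) ^ 2 / 2)) := by
  rw [gaussianReal_of_var_ne_zero m' one_ne_zero, gaussianReal_of_var_ne_zero m one_ne_zero,
    ← withDensity_mul _ (measurable_gaussianPDF _ _) (by fun_prop)]
  congr 1
  funext x
  simp only [Pi.mul_apply, gaussianPDF]
  rw [← ENNReal.ofReal_mul (gaussianPDFReal_nonneg m 1 x)]
  simp only [gaussianPDFReal]
  rw [mul_assoc (_⁻¹), ← Real.exp_add]
  congr 3
  simp only [NNReal.coe_one]
  ring

variable {A B O : Type*} [MeasurableSpace A] [MeasurableSpace B] [MeasurableSpace O]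
  [Finite A] [MeasurableSingletonClass A] [Finite B] [MeasurableSingletonClass B]

/-- The log-likelihood ratio of one round between the instances `I'` and `I`, if they differ only
in the mean rewards of the follower. -/
def roundLogLik (I I' : GameInstance A B) (x : Round A B) : ℝ :=
  (I'.v₂ x.1.1 x.1.2 - I.v₂ x.1.1 x.1.2) * (x.2.2 - I.v₂ x.1.1 x.1.2) -
    (I'.v₂ x.1.1 x.1.2 - I.v₂ x.1.1 x.1.2) ^ 2 / 2

theorem measurable_roundLogLik (I I' : GameInstance A B) : Measurable (roundLogLik I I') := by
  have h : Measurable fun x : Round A B => I.v₂ x.1.1 x.1.2 :=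
    (Measurable.of_discrete (f := fun p : A × B => I.v₂ p.1 p.2)).comp measurable_fst
  have h' : Measurable fun x : Round A B => I'.v₂ x.1.1 x.1.2 :=
    (Measurable.of_discrete (f := fun p : A × B => I'.v₂ p.1 p.2)).comp measurable_fst
  unfold roundLogLik
  fun_prop

/-- The log-likelihood ratio of `T` rounds. -/
def logLik (I I' : GameInstance A B) {T : ℕ} (h : Fin T → Round A B) : ℝ :=
  ∑ t, roundLogLik I I' (h t)

theorem measurable_logLik (I I' : GameInstance A B) (T : ℕ) :
    Measurable (logLik I I' : (Fin T → Round A B) → ℝ) :=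
  Finset.measurable_fun_sum _ fun t _ =>
    (measurable_roundLogLik I I').comp (measurable_pi_apply t)

variable (I I' : GameInstance A B) (hv : I'.v₁ = I.v₁) (L : LeaderAlg O A)
  (obs : Round A B → O) (hobs : Measurable obs) (F : FollowerAlg A B)

include hv in
theorem lintegral_rewardKernel_change (p : A × B) {f : ℝ × ℝ → ENNReal} (hf : Measurable f) :
    ∫⁻ r, f r ∂(rewardKernel I' p) =
      ∫⁻ r, ENNReal.ofReal (Real.exp (roundLogLik I I' (p, r))) * f r ∂(rewardKernel I p) := by
  have hm : Measurable fun r : ℝ × ℝ =>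
      ENNReal.ofReal (Real.exp (roundLogLik I I' (p, r))) := by
    have := measurable_roundLogLik I I'
    fun_prop
  change ∫⁻ r, f r ∂((gaussianReal (I'.v₁ p.1 p.2) 1).prod (gaussianReal (I'.v₂ p.1 p.2) 1)) =
    ∫⁻ r, ENNReal.ofReal (Real.exp (roundLogLik I I' (p, r))) * f r
      ∂((gaussianReal (I.v₁ p.1 p.2) 1).prod (gaussianReal (I.v₂ p.1 p.2) 1))
  have hmf : Measurable fun r : ℝ × ℝ =>
      ENNReal.ofReal (Real.exp (roundLogLik I I' (p, r))) * f r := hm.mul hf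
  rw [lintegral_prod _ hf.aemeasurable, lintegral_prod _ hmf.aemeasurable, hv]
  refine lintegral_congr fun x => ?_
  rw [gaussianReal_eq_withDensity (I.v₂ p.1 p.2) (I'.v₂ p.1 p.2),
    lintegral_withDensity_eq_lintegral_mul _ (by fun_prop) (by fun_prop)]
  rfl

include hv in
/-- The law of the interaction under `I'` has the likelihood ratio as its density with respect to
the law under `I`: the algorithms contribute the same factors to both. -/
theorem law_eq_withDensity (T : ℕ) :
    law I' L obs hobs F T = (law I L obs hobs F T).withDensity fun h =>
      ENNReal.ofReal (Real.exp (logLik I I' h)) := by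
  have hm : ∀ T, Measurable fun h : Fin T → Round A B =>
      ENNReal.ofReal (Real.exp (logLik I I' h)) := fun T =>
    (measurable_logLik I I' T).exp.ennreal_ofReal
  have hr : Measurable fun x : Round A B => ENNReal.ofReal (Real.exp (roundLogLik I I' x)) :=
    (measurable_roundLogLik I I').exp.ennreal_ofReal
  induction T with
  | zero => simp [law, logLik]
  | succ T ih =>
    refine Measure.ext_of_lintegral _ fun f hf => ?_
    have hfs : ∀ h : Fin T → Round A B, Measurable fun x : Round A B =>
        f (Fin.snoc (α := fun _ => Round A B) h x) := fun h =>
      hf.comp ((measurable_snoc T).comp measurable_prodMk_left)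
    have hround : Measurable fun h : Fin T → Round A B =>
        ∫⁻ x, f (Fin.snoc (α := fun _ => Round A B) h x) ∂(roundKernel I' L obs hobs F T h) :=
      (hf.comp (measurable_snoc T)).lintegral_kernel_prod_right'
    rw [lintegral_withDensity_eq_lintegral_mul _ (hm _) hf,
      lintegral_law_succ I L obs hobs F T ((hm _).mul hf),
      lintegral_law_succ I' L obs hobs F T hf, ih,
      lintegral_withDensity_eq_lintegral_mul _ (hm _) hround]
    refine lintegral_congr fun h => ?_
    simp only [Pi.mul_apply]
    have hsplit : ∀ x : Round A B,
        ENNReal.ofReal (Real.exp (logLik I I' (Fin.snoc (α := fun _ => Round A B) h x))) =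
          ENNReal.ofReal (Real.exp (logLik I I' h)) *
            ENNReal.ofReal (Real.exp (roundLogLik I I' x)) := fun x => by
      rw [← ENNReal.ofReal_mul (by positivity), ← Real.exp_add]
      simp [logLik, Fin.sum_univ_castSucc]
    simp only [hsplit, mul_assoc]
    have hrf : Measurable fun x : Round A B => ENNReal.ofReal (Real.exp (roundLogLik I I' x)) *
        f (Fin.snoc (α := fun _ => Round A B) h x) := hr.mul (hfs h)
    rw [lintegral_const_mul _ hrf, lintegral_roundKernel I' L obs hobs F h (hfs h),
      lintegral_roundKernel I L obs hobs F h hrf]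
    congr 1
    refine lintegral_congr fun p => ?_
    exact lintegral_rewardKernel_change I I' hv p ((hfs h).comp measurable_prodMk_left)

theorem integrable_roundLogLik (p : A × B) :
    Integrable (fun r => roundLogLik I I' (p, r)) (rewardKernel I p) := by
  have h : Integrable (fun r : ℝ × ℝ => r.2 - I.v₂ p.1 p.2) (rewardKernel I p) :=
    (integrable_snd_rewardKernel I p).sub (integrable_const _)
  exact (h.const_mul (I'.v₂ p.1 p.2 - I.v₂ p.1 p.2)).sub
    (integrable_const ((I'.v₂ p.1 p.2 - I.v₂ p.1 p.2) ^ 2 / 2))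

theorem integral_roundLogLik (p : A × B) :
    ∫ r, roundLogLik I I' (p, r) ∂(rewardKernel I p) =
      -((I'.v₂ p.1 p.2 - I.v₂ p.1 p.2) ^ 2 / 2) := by
  have h : Integrable (fun r : ℝ × ℝ => r.2 - I.v₂ p.1 p.2) (rewardKernel I p) :=
    (integrable_snd_rewardKernel I p).sub (integrable_const _)
  have h0 : ∫ r : ℝ × ℝ, (r.2 - I.v₂ p.1 p.2) ∂(rewardKernel I p) = 0 := by
    rw [integral_sub (integrable_snd_rewardKernel I p) (integrable_const _),
      integral_snd_rewardKernel]
    simp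
  unfold roundLogLik
  dsimp only
  rw [integral_sub (h.const_mul _) (integrable_const _), integral_const_mul, h0]
  simp

theorem integrable_logLik (T : ℕ) :
    Integrable (logLik I I') (law I L obs hobs F T) :=
  integrable_finsetSum _ fun t _ => integrable_law_apply I L obs hobs F t
    (measurable_roundLogLik I I') (integrable_roundLogLik I I')

/-- The negative of the relative entropy between the two laws (the divergence decomposition). -/
theorem integral_logLik (T : ℕ) :
    ∫ h, logLik I I' h ∂(law I L obs hobs F T) =
      -∑ t : Fin T, ∫ h, (I'.v₂ (h t).1.1 (h t).1.2 - I.v₂ (h t).1.1 (h t).1.2) ^ 2 / 2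
        ∂(law I L obs hobs F T) := by
  unfold logLik
  rw [integral_finsetSum _ fun t _ => integrable_law_apply I L obs hobs F t
    (measurable_roundLogLik I I') (integrable_roundLogLik I I'), ← Finset.sum_neg_distrib]
  refine Finset.sum_congr rfl fun t _ => ?_
  rw [integral_law_apply I L obs hobs F t (measurable_roundLogLik I I')
    (integrable_roundLogLik I I'), ← integral_neg]
  simp only [integral_roundLogLik]

/-- A weak form of Pinsker's inequality, pointwise: with `x = exp (l / 2)` one has
`|1 - x ^ 2| ≤ 4 (1 - x) ^ 2 + (1 + x) ^ 2 / 16` and `(1 - x) ^ 2 ≤ x ^ 2 - 1 - l`. -/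
theorem mul_exp_lower_bound {l f : ℝ} (hf0 : 0 ≤ f) (hf1 : f ≤ 1) :
    f - 4 * (Real.exp l - 1 - l) - (1 + Real.exp l) / 8 ≤ Real.exp l * f := by
  obtain ⟨x, hx⟩ : ∃ x, x = Real.exp (l / 2) := ⟨_, rfl⟩
  have hsq : Real.exp l = x ^ 2 := by rw [hx, ← Real.exp_nat_mul]; congr 1; push_cast; ring
  have hx1 : 1 + l / 2 ≤ x := by have := Real.add_one_le_exp (l / 2); linarith
  rw [hsq]
  have hx0 : 0 < x := hx ▸ Real.exp_pos _
  have hamgm : 1 - x ^ 2 ≤ 4 * (1 - x) ^ 2 + (1 + x) ^ 2 / 16 := by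
    nlinarith [sq_nonneg (2 * (1 - x) - (1 + x) / 4)]
  have hmul : f * (1 - x ^ 2) ≤ 4 * (1 - x) ^ 2 + (1 + x) ^ 2 / 16 := by
    rcases le_total 0 (1 - x ^ 2) with h | h
    · nlinarith
    · nlinarith [sq_nonneg (1 - x), sq_nonneg (1 + x)]
  nlinarith [sq_nonneg (1 - x)]

/-- If the density `exp l` of a probability measure has small relative entropy `-∫ l`, then the
expectation of a `[0, 1]`-valued function does not drop much under the change of measure. -/
theorem integral_withDensity_exp_ge {Ω : Type*} [MeasurableSpace Ω] {P Q : Measure Ω}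
    [IsProbabilityMeasure P] [IsProbabilityMeasure Q] {l f : Ω → ℝ} (hl : Measurable l)
    (hQ : Q = P.withDensity fun ω => ENNReal.ofReal (Real.exp (l ω))) (hint : Integrable l P)
    (hf : Measurable f) (hf0 : ∀ ω, 0 ≤ f ω) (hf1 : ∀ ω, f ω ≤ 1) :
    ∫ ω, f ω ∂P - 1 / 4 + 4 * ∫ ω, l ω ∂P ≤ ∫ ω, f ω ∂Q := by
  have hmass : ∫⁻ ω, ENNReal.ofReal (Real.exp (l ω)) ∂P = 1 := by
    rw [← setLIntegral_univ, ← withDensity_apply _ MeasurableSet.univ, ← hQ, measure_univ]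
  have hexp : Integrable (fun ω => Real.exp (l ω)) P :=
    ⟨hl.exp.aestronglyMeasurable, by
      rw [hasFiniteIntegral_iff_ofReal (.of_forall fun ω => (Real.exp_pos _).le), hmass]
      exact ENNReal.one_lt_top⟩
  have hexp1 : ∫ ω, Real.exp (l ω) ∂P = 1 := by
    rw [integral_eq_lintegral_of_nonneg_ae (.of_forall fun ω => (Real.exp_pos _).le)
      hl.exp.aestronglyMeasurable, hmass, ENNReal.toReal_one]
  have hfbd : ∀ ω, ‖f ω‖ ≤ 1 := fun ω => by
    rw [Real.norm_of_nonneg (hf0 ω)]; exact hf1 ω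
  have hfint : Integrable f P := .of_bound hf.aestronglyMeasurable 1 (.of_forall hfbd)
  have hprod : Integrable (fun ω => Real.exp (l ω) * f ω) P :=
    hexp.mul_bdd hf.aestronglyMeasurable (.of_forall hfbd)
  have hi1 : Integrable (fun ω => Real.exp (l ω) - 1 - l ω) P :=
    (hexp.sub (integrable_const _)).sub hint
  have hi2 : Integrable (fun ω => 1 + Real.exp (l ω)) P := (integrable_const _).add hexp
  have hi3 : Integrable (fun ω => f ω - 4 * (Real.exp (l ω) - 1 - l ω)) P :=
    hfint.sub (hi1.const_mul 4)
  have hi4 : Integrable (fun ω => Real.exp (l ω) - 1) P := hexp.sub (integrable_const _)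
  have hmono := integral_mono (hi3.sub (hi2.div_const 8)) hprod
    fun ω => mul_exp_lower_bound (hf0 ω) (hf1 ω) (l := l ω)
  have hQf : ∫ ω, f ω ∂Q = ∫ ω, Real.exp (l ω) * f ω ∂P := by
    rw [hQ, integral_withDensity_eq_integral_toReal_smul hl.exp.ennreal_ofReal
      (.of_forall fun ω => ENNReal.ofReal_lt_top)]
    simp [ENNReal.toReal_ofReal (Real.exp_pos _).le]
  have hleft : ∫ ω, (f ω - 4 * (Real.exp (l ω) - 1 - l ω) - (1 + Real.exp (l ω)) / 8) ∂P =
      ∫ ω, f ω ∂P - 1 / 4 + 4 * ∫ ω, l ω ∂P := by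
    rw [integral_sub hi3 (hi2.div_const 8),
      integral_sub hfint (hi1.const_mul 4), integral_const_mul, integral_div,
      integral_sub hi4 hint,
      integral_sub hexp (integrable_const _), integral_add (integrable_const _) hexp, hexp1]
    simp
    ring
  rw [hQf, ← hleft]
  exact hmono

end ChangeOfMeasure

/-! ### Expected totals over the horizon -/

section Total

variable {A B O : Type*} [MeasurableSpace A] [MeasurableSpace B] [MeasurableSpace O]
  [Finite A] [MeasurableSingletonClass A] [Finite B] [MeasurableSingletonClass B]
  (I I' : GameInstance A B) (L : LeaderAlg O A) (obs : Round A B → O) (hobs : Measurable obs)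
  (F : FollowerAlg A B) (T : ℕ)

/-- The expected total `E[∑ t, g (a_t, b_t)]` over `T` rounds of a function of the action pair. For
an indicator function `g` this is an expected number of rounds. -/
def expectedTotal (g : A × B → ℝ) : ℝ :=
  ∑ t : Fin T, ∫ h, g (h t).1 ∂(law I L obs hobs F T)

theorem expectedTotal_const (c : ℝ) :
    expectedTotal I L obs hobs F T (fun _ => c) = T * c := by
  simp [expectedTotal]

theorem expectedTotal_sub (g g' : A × B → ℝ) :
    expectedTotal I L obs hobs F T (fun p => g p - g' p) =
      expectedTotal I L obs hobs F T g - expectedTotal I L obs hobs F T g' := by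
  unfold expectedTotal
  rw [← Finset.sum_sub_distrib]
  exact Finset.sum_congr rfl fun t _ => integral_sub (integrable_law_action I L obs hobs F t g)
    (integrable_law_action I L obs hobs F t g')

theorem expectedTotal_const_mul (c : ℝ) (g : A × B → ℝ) :
    expectedTotal I L obs hobs F T (fun p => c * g p) =
      c * expectedTotal I L obs hobs F T g := by
  unfold expectedTotal
  rw [Finset.mul_sum]
  exact Finset.sum_congr rfl fun t _ => integral_const_mul _ _

theorem expectedTotal_finset_sum {ι : Type*} (s : Finset ι) (g : ι → A × B → ℝ) :
    expectedTotal I L obs hobs F T (fun p => ∑ i ∈ s, g i p) =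
      ∑ i ∈ s, expectedTotal I L obs hobs F T (g i) := by
  unfold expectedTotal
  rw [Finset.sum_comm]
  exact Finset.sum_congr rfl fun t _ => integral_finsetSum _ fun i _ =>
    integrable_law_action I L obs hobs F t (g i)

theorem expectedTotal_mono {g g' : A × B → ℝ} (hg : ∀ p, g p ≤ g' p) :
    expectedTotal I L obs hobs F T g ≤ expectedTotal I L obs hobs F T g' :=
  Finset.sum_le_sum fun t _ => integral_mono (integrable_law_action I L obs hobs F t g)
    (integrable_law_action I L obs hobs F t g') fun h => hg (h t).1

theorem expectedTotal_nonneg {g : A × B → ℝ} (hg : ∀ p, 0 ≤ g p) :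
    0 ≤ expectedTotal I L obs hobs F T g :=
  Finset.sum_nonneg fun _ _ => integral_nonneg fun _ => hg _

theorem leaderRegret_eq (γ : ℝ) :
    leaderRegret γ I L obs hobs F T = I.leaderBenchmark γ * T -
      expectedTotal I L obs hobs F T (fun p => I.v₁ p.1 p.2) := by
  simp only [leaderRegret, expectedTotal, integral_leader_reward]

theorem followerRegret_eq (γ : ℝ) :
    followerRegret γ I L obs hobs F T = I.followerBenchmark γ * T -
      expectedTotal I L obs hobs F T (fun p => I.v₂ p.1 p.2) := by
  simp only [followerRegret, expectedTotal, integral_follower_reward]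

/-- If two instances differ only in the mean rewards of the follower, an expected number of rounds
under `I'` is controlled by that under `I` and by the relative entropy of the two laws. -/
theorem expectedTotal_change (hv : I'.v₁ = I.v₁) {g : A × B → ℝ} (hg0 : ∀ p, 0 ≤ g p)
    (hg1 : ∀ p, g p ≤ 1) :
    expectedTotal I L obs hobs F T g - T / 4 - 4 * T *
        expectedTotal I L obs hobs F T (fun p => (I'.v₂ p.1 p.2 - I.v₂ p.1 p.2) ^ 2 / 2) ≤
      expectedTotal I' L obs hobs F T g := by
  rcases Nat.eq_zero_or_pos T with rfl | hT
  · simp [expectedTotal]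
  have hT' : (0 : ℝ) < T := by exact_mod_cast hT
  have hmeas : ∀ t : Fin T, Measurable fun h : Fin T → Round A B => g (h t).1 := fun t =>
    (Measurable.of_discrete (f := g)).comp (by fun_prop)
  have hsum : ∀ J : GameInstance A B, ∫ h, (∑ t : Fin T, g (h t).1) / T ∂(law J L obs hobs F T) =
      expectedTotal J L obs hobs F T g / T := fun J => by
    rw [integral_div, integral_finsetSum _ fun t _ => integrable_law_action J L obs hobs F t g]
    rfl
  have key := integral_withDensity_exp_ge (f := fun h => (∑ t : Fin T, g (h t).1) / T)
    (measurable_logLik I I' T)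
    (law_eq_withDensity I I' hv L obs hobs F T) (integrable_logLik I I' L obs hobs F T)
    ((Finset.measurable_fun_sum _ fun t _ => hmeas t).div_const _)
    (fun h => div_nonneg (Finset.sum_nonneg fun t _ => hg0 _) hT'.le)
    (fun h => by
      rw [div_le_one hT']
      calc ∑ t : Fin T, g (h t).1 ≤ ∑ _t : Fin T, (1 : ℝ) := Finset.sum_le_sum fun t _ => hg1 _
        _ = T := by simp)
  rw [hsum, hsum, integral_logLik] at key
  change _ + 4 * -expectedTotal I L obs hobs F T
    (fun p => (I'.v₂ p.1 p.2 - I.v₂ p.1 p.2) ^ 2 / 2) ≤ _ at key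
  rw [le_div_iff₀ hT'] at key
  have : expectedTotal I L obs hobs F T g / T * T = expectedTotal I L obs hobs F T g :=
    div_mul_cancel₀ _ hT'.ne'
  linarith

end Total

/-! ### The hard instances -/

section Hard

variable {A B : Type*}

open Classical in
/-- The hard instances. Every action of the leader other than the risky action `a₂` pays `1 / 2` to
the leader and `3 δ` to the follower, whatever the response. On `a₂` the leader gains from the
response `b₀` only, by a margin `δ` over the safe actions. The follower's rewards on `a₂` are `δ` for
`b₀`, `2 δ` for a hidden bonus response `j` and `0` otherwise; `j = none` means that there is no
bonus response. -/
def hardInstance (a₂ : A) (b₀ : B) (j : Option B) {δ : ℝ} (h0 : 0 ≤ δ) (h1 : δ ≤ 1 / 6) :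
    GameInstance A B where
  v₁ a b := if a = a₂ then (if b = b₀ then 1 / 2 + δ else 0) else 1 / 2
  v₂ a b := if a = a₂ then (if j = some b then 2 * δ else if b = b₀ then δ else 0) else 3 * δ
  v₁_mem a b := by split_ifs <;> constructor <;> linarith
  v₂_mem a b := by split_ifs <;> constructor <;> linarith

variable [Finite A] [Finite B] {a₂ : A} {b₀ : B} {δ : ℝ} (h0 : 0 < δ) (h1 : δ ≤ 1 / 6)

/-- Without a bonus response, a tolerance below `δ` leaves `b₀` as the only answer to `a₂`, and a
larger one costs as much as `a₂` would gain. -/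
theorem le_leaderBenchmark_hardInstance {a₁ : A} (ha : a₁ ≠ a₂) {γ : ℝ} (hγ : 0 ≤ γ) :
    1 / 2 + δ ≤ (hardInstance a₂ b₀ none h0.le h1).leaderBenchmark γ := by
  set I := hardInstance a₂ b₀ none h0.le h1 with hI
  have : Nonempty B := ⟨b₀⟩
  have : Nonempty (Set.Icc (0 : ℝ) γ) := ⟨⟨0, le_rfl, hγ⟩⟩
  refine le_ciInf fun ⟨ε, hε0, _⟩ => ?_
  have hne : ∀ a, Nonempty (I.followerBR ε a) := fun a =>
    (I.followerBR_nonempty hε0 a).to_subtype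
  have hle : ∀ a c, (∀ b ∈ I.followerBR ε a, c ≤ I.v₁ a b) → c ≤ I.leaderRelaxed ε :=
    fun a c h => le_ciSup_of_le (Set.finite_range _).bddAbove a (le_ciInf fun b => h b b.2)
  dsimp only
  rcases lt_or_ge ε δ with hε | hε
  · have hsup : δ ≤ ⨆ b', I.v₂ a₂ b' :=
      le_ciSup_of_le (Set.finite_range _).bddAbove b₀ (by simp [hI, hardInstance])
    have := hle a₂ (1 / 2 + δ) fun b hb => by
      have hb' : (⨆ b', I.v₂ a₂ b') - ε ≤ I.v₂ a₂ b := hb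
      have hbb : b = b₀ := by
        by_contra hne
        have : I.v₂ a₂ b = 0 := by simp [hI, hardInstance, hne]
        linarith
      simp [hI, hardInstance, hbb]
    linarith
  · have := hle a₁ (1 / 2) fun b _ => by simp [hI, hardInstance, ha]
    linarith

/-- With a bonus response `j ≠ b₀`, a tolerance below `δ` makes `a₂` worthless to the leader, who is
thus expected to play a safe action, and a larger one costs as much as `a₂` takes from the
follower. -/
theorem le_followerBenchmark_hardInstance {a₁ : A} (ha : a₁ ≠ a₂) {j : B} (hj : j ≠ b₀) {γ : ℝ}
    (hγ : 0 ≤ γ) :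
    3 * δ ≤ (hardInstance a₂ b₀ (some j) h0.le h1).followerBenchmark γ := by
  set I := hardInstance a₂ b₀ (some j) h0.le h1 with hI
  have : Nonempty A := ⟨a₁⟩
  have : Nonempty B := ⟨b₀⟩
  have : Nonempty (Set.Icc (0 : ℝ) γ) := ⟨⟨0, le_rfl, hγ⟩⟩
  refine le_ciInf fun ⟨ε, hε0, _⟩ => ?_
  have hne : ∀ a, Nonempty (I.followerBR ε a) := fun a =>
    (I.followerBR_nonempty hε0 a).to_subtype
  have : Nonempty (I.leaderBR ε) := (I.leaderBR_nonempty hε0).to_subtype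
  have hsup : ∀ a b, I.v₂ a b ≤ ⨆ b', I.v₂ a b' := fun a b =>
    le_ciSup (Set.finite_range _).bddAbove b
  have hv₂ : I.v₂ a₂ j = 2 * δ := by simp [hI, hardInstance]
  have hsafe : ∀ a, a ≠ a₂ → 3 * δ ≤ ⨆ b', I.v₂ a b' := fun a h =>
    (by simp [hI, hardInstance, h] : 3 * δ ≤ I.v₂ a b₀).trans (hsup a b₀)
  dsimp only
  suffices h : 3 * δ - ε ≤ I.followerRelaxed ε by linarith
  refine le_ciInf fun ⟨a, haε⟩ => ?_
  dsimp only
  by_cases haa : a = a₂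
  · subst haa
    rcases lt_or_ge ε δ with hε | hε
    · have hrel : 1 / 2 ≤ I.leaderRelaxed ε :=
        le_ciSup_of_le (Set.finite_range _).bddAbove a₁
          (le_ciInf fun b => by simp [hI, hardInstance, ha])
      have hzero : (⨆ b : I.followerBR ε a, I.v₁ a b) ≤ 0 := ciSup_le fun ⟨b, hb⟩ => by
        have hb' : (⨆ b', I.v₂ a b') - ε ≤ I.v₂ a b := hb
        have hbne : b ≠ b₀ := by
          rintro rfl
          have : I.v₂ a b = δ := by simp [hI, hardInstance, hj]
          linarith [hsup a j]
        simp [hI, hardInstance, hbne]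
      have haε' : I.leaderRelaxed ε - ε ≤ ⨆ b : I.followerBR ε a, I.v₁ a b := haε
      linarith
    · linarith [hsup a j]
  · linarith [hsafe a haa]

end Hard

/-! ### The trade-off between exploration and commitment -/

section Regret

variable {A B O : Type*} [MeasurableSpace A] [MeasurableSpace B] [MeasurableSpace O]
  [Finite A] [MeasurableSingletonClass A] [Fintype B] [MeasurableSingletonClass B]
  (L : LeaderAlg O A) (obs : Round A B → O) (hobs : Measurable obs) (F : FollowerAlg A B) (T : ℕ)
  {a₁ a₂ : A} (ha : a₁ ≠ a₂) {b₀ : B} {δ : ℝ} (h0 : 0 < δ) (h1 : δ ≤ 1 / 6)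

open Classical in
/-- The indicator function of the rounds in which the leader plays a safe action. -/
def safeIndicator (a₂ : A) (p : A × B) : ℝ := if p.1 = a₂ then 0 else 1

open Classical in
/-- The indicator function of the rounds in which the players play the action pair `q`. -/
def pairIndicator (q p : A × B) : ℝ := if p = q then 1 else 0

open Classical in
include ha in
/-- Without a bonus response, the leader pays `δ` for a safe round and a constant for a round in
which a response other than `b₀` is tried out on `a₂`. -/
theorem leaderRegret_hardInstance_ge {γ : ℝ} (hγ : 0 ≤ γ) :
    δ * expectedTotal (hardInstance a₂ b₀ none h0.le h1) L obs hobs F T (safeIndicator a₂) +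
      1 / 2 * ∑ b ∈ Finset.univ.erase b₀,
        expectedTotal (hardInstance a₂ b₀ none h0.le h1) L obs hobs F T (pairIndicator (a₂, b)) ≤
      leaderRegret γ (hardInstance a₂ b₀ none h0.le h1) L obs hobs F T := by
  have hbench := le_leaderBenchmark_hardInstance (b₀ := b₀) h0 h1 ha hγ
  set I := hardInstance a₂ b₀ none h0.le h1 with hI
  rw [leaderRegret_eq, ← expectedTotal_finset_sum, ← expectedTotal_const_mul,
    ← expectedTotal_const_mul]
  have hmono := expectedTotal_mono I L obs hobs F T
    (g := fun p => I.v₁ p.1 p.2)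
    (g' := fun p => (1 / 2 + δ - δ * safeIndicator a₂ p) -
      1 / 2 * ∑ b ∈ Finset.univ.erase b₀, pairIndicator (a₂, b) p) fun ⟨a, b⟩ => by
    by_cases haa : a = a₂
    · subst haa
      by_cases hb : b = b₀
      · have : ∑ b' ∈ Finset.univ.erase b₀, pairIndicator (a, b') (a, b) = 0 :=
          Finset.sum_eq_zero fun b' hb' => by
            have : b ≠ b' := fun h => (Finset.ne_of_mem_erase hb') (h.symm.trans hb)
            simp [pairIndicator, this]
        rw [this]
        simp [hI, hardInstance, safeIndicator, hb]
      · have : ∑ b' ∈ Finset.univ.erase b₀, pairIndicator (a, b') (a, b) = 1 := by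
          rw [Finset.sum_eq_single_of_mem b (by simp [hb])]
          · simp [pairIndicator]
          · intro b' _ h
            simp [pairIndicator, h.symm]
        rw [this]
        simp [hI, hardInstance, safeIndicator, hb]
        linarith
    · simp [hI, hardInstance, safeIndicator, pairIndicator, haa]
  rw [expectedTotal_sub, expectedTotal_sub, expectedTotal_const] at hmono
  have := mul_le_mul_of_nonneg_right hbench (Nat.cast_nonneg (α := ℝ) T)
  linarith

include ha in
/-- With a bonus response, the follower pays `δ` for every round that is not safe. -/
theorem followerRegret_hardInstance_ge {j : B} (hj : j ≠ b₀) {γ : ℝ} (hγ : 0 ≤ γ) :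
    δ * expectedTotal (hardInstance a₂ b₀ (some j) h0.le h1) L obs hobs F T
        (fun p => 1 - safeIndicator a₂ p) ≤
      followerRegret γ (hardInstance a₂ b₀ (some j) h0.le h1) L obs hobs F T := by
  have hbench := le_followerBenchmark_hardInstance h0 h1 ha hj hγ
  set I := hardInstance a₂ b₀ (some j) h0.le h1 with hI
  rw [followerRegret_eq, ← expectedTotal_const_mul]
  have hmono := expectedTotal_mono I L obs hobs F T
    (g := fun p => I.v₂ p.1 p.2)
    (g' := fun p => 3 * δ - δ * (1 - safeIndicator a₂ p)) fun ⟨a, b⟩ => by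
    simp only [hI, hardInstance, safeIndicator]
    split_ifs <;> linarith
  rw [expectedTotal_sub, expectedTotal_const] at hmono
  have := mul_le_mul_of_nonneg_right hbench (Nat.cast_nonneg (α := ℝ) T)
  linarith

/-- The bonus response `j` is invisible until it is tried: rounds that are not safe stay frequent
after its introduction, up to the relative entropy of `2 δ ^ 2` per trial. -/
theorem expectedTotal_hardInstance_change {j : B} (hj : j ≠ b₀) :
    3 / 4 * T -
        expectedTotal (hardInstance a₂ b₀ none h0.le h1) L obs hobs F T (safeIndicator a₂) -
        8 * T * δ ^ 2 * expectedTotal (hardInstance a₂ b₀ none h0.le h1) L obs hobs F T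
          (pairIndicator (a₂, j)) ≤
      expectedTotal (hardInstance a₂ b₀ (some j) h0.le h1) L obs hobs F T
        (fun p => 1 - safeIndicator a₂ p) := by
  have key := expectedTotal_change (hardInstance a₂ b₀ none h0.le h1)
    (hardInstance a₂ b₀ (some j) h0.le h1) L obs hobs F T rfl
    (g := fun p => 1 - safeIndicator a₂ p)
    (fun p => by unfold safeIndicator; split_ifs <;> norm_num)
    (fun p => by unfold safeIndicator; split_ifs <;> norm_num)
  have hkl : (fun p : A × B => ((hardInstance a₂ b₀ (some j) h0.le h1).v₂ p.1 p.2 -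
      (hardInstance a₂ b₀ none h0.le h1).v₂ p.1 p.2) ^ 2 / 2) =
      fun p => 2 * δ ^ 2 * pairIndicator (a₂, j) p := by
    funext ⟨a, b⟩
    by_cases haa : a = a₂
    · by_cases hb : b = j
      · simp [hardInstance, pairIndicator, haa, hb, hj]; ring
      · simp [hardInstance, pairIndicator, haa, hb, Ne.symm hb]
    · simp [hardInstance, pairIndicator, haa]
  rw [hkl, expectedTotal_const_mul, expectedTotal_sub, expectedTotal_const] at key
  linarith

include ha in
theorem exists_instance_regret_ge (hB : 2 ≤ Fintype.card B) (hT : Fintype.card B ≤ T) :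
    ∃ I : GameInstance A B, ∀ γ : ℝ, 0 < γ → γ ≤ 1 →
      1 / 100 * ((T : ℝ) ^ (2 / 3 : ℝ) * (Fintype.card B : ℝ) ^ (1 / 3 : ℝ)) ≤
        max (leaderRegret γ I L obs hobs F T) (followerRegret γ I L obs hobs F T) := by
  classical
  obtain ⟨b₀⟩ : Nonempty B := Fintype.card_pos_iff.mp (by omega)
  obtain ⟨n, hn⟩ : ∃ n : ℝ, n = Fintype.card B := ⟨_, rfl⟩
  have hn2 : 2 ≤ n := by rw [hn]; exact_mod_cast hB
  have hnT : n ≤ T := by rw [hn]; exact_mod_cast hT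
  have hTpos : (0 : ℝ) < T := by linarith
  -- The gap `δ = u / 6` balances the cost `n / δ ^ 2` of finding the bonus response
  -- against the cost `δ T` of not looking for it.
  obtain ⟨u, hu⟩ : ∃ u : ℝ, u = (n / T) ^ (1 / 3 : ℝ) := ⟨_, rfl⟩
  have hu0 : 0 < u := by rw [hu]; positivity
  have hu1 : u ≤ 1 := by
    rw [hu]
    exact Real.rpow_le_one (by positivity) ((div_le_one hTpos).mpr hnT) (by norm_num)
  have hu3 : u ^ 3 * T = n := by
    rw [hu, ← Real.rpow_natCast, ← Real.rpow_mul (by positivity)]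
    norm_num
    field_simp
  have hrate : (T : ℝ) ^ (2 / 3 : ℝ) * n ^ (1 / 3 : ℝ) = T * u := by
    rw [hu, Real.div_rpow (by linarith) hTpos.le, mul_div_assoc', eq_div_iff (by positivity),
      mul_right_comm, ← Real.rpow_add hTpos]
    norm_num
  rw [← hn, hrate]
  have h0 : 0 < u / 6 := by linarith
  have h1 : u / 6 ≤ 1 / 6 := by linarith
  obtain ⟨X, hX⟩ : ∃ X, X = expectedTotal (hardInstance a₂ b₀ none h0.le h1) L obs hobs F T
    (safeIndicator a₂) := ⟨_, rfl⟩
  obtain ⟨Y, hY⟩ : ∃ Y : B → ℝ, Y = fun b => expectedTotal (hardInstance a₂ b₀ none h0.le h1)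
    L obs hobs F T (pairIndicator (a₂, b)) := ⟨_, rfl⟩
  have hX0 : 0 ≤ X := hX ▸ expectedTotal_nonneg _ L obs hobs F T fun p => by
    unfold safeIndicator; split_ifs <;> norm_num
  have hY0 : ∀ b, 0 ≤ Y b := fun b => hY ▸ expectedTotal_nonneg _ L obs hobs F T fun p => by
    unfold pairIndicator; split_ifs <;> norm_num
  by_cases hcase : 1 / 100 * (T * u) ≤ u / 6 * X + 1 / 2 * ∑ b ∈ Finset.univ.erase b₀, Y b
  · refine ⟨hardInstance a₂ b₀ none h0.le h1, fun γ hγ _ => le_max_of_le_left (hcase.trans ?_)⟩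
    subst hX hY
    exact leaderRegret_hardInstance_ge L obs hobs F T ha h0 h1 hγ.le
  · push Not at hcase
    have hsum0 : 0 ≤ ∑ b ∈ Finset.univ.erase b₀, Y b := Finset.sum_nonneg fun b _ => hY0 b
    have hXle : X ≤ 6 / 100 * T := by
      have : u * X ≤ u * (6 / 100 * T) := by linarith
      exact le_of_mul_le_mul_left this hu0
    -- Some response other than `b₀` is tried no more often than the average.
    obtain ⟨j, hj, hYj⟩ : ∃ j ∈ Finset.univ.erase b₀, Y j ≤ T * u / 50 / (n - 1) := by
      refine Finset.exists_le_of_sum_le ?_ ?_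
      · rw [← Finset.card_pos, Finset.card_erase_of_mem (Finset.mem_univ _), Finset.card_univ]
        omega
      · rw [Finset.sum_const, Finset.card_erase_of_mem (Finset.mem_univ _), Finset.card_univ,
          nsmul_eq_mul, Nat.cast_sub (by omega), ← hn, Nat.cast_one,
          mul_div_cancel₀ _ (by linarith)]
        have := mul_nonneg h0.le hX0
        linarith
    have hj : j ≠ b₀ := Finset.ne_of_mem_erase hj
    have hYn : n * Y j ≤ T * u / 25 := by
      rw [le_div_iff₀ (by linarith)] at hYj
      nlinarith [hY0 j]
    have hkl : u ^ 2 * Y j ≤ 1 / 25 := by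
      have : n * (u ^ 2 * Y j) ≤ n * (1 / 25) := by
        calc n * (u ^ 2 * Y j) = u ^ 2 * (n * Y j) := by ring
          _ ≤ u ^ 2 * (T * u / 25) := by gcongr
          _ = u ^ 3 * T / 25 := by ring
          _ = n * (1 / 25) := by rw [hu3]; ring
      exact le_of_mul_le_mul_left this (by linarith)
    refine ⟨hardInstance a₂ b₀ (some j) h0.le h1, fun γ hγ _ => le_max_of_le_right ?_⟩
    refine le_trans ?_ (followerRegret_hardInstance_ge L obs hobs F T ha h0 h1 hj hγ.le)
    have hchange := expectedTotal_hardInstance_change L obs hobs F T (a₂ := a₂) h0 h1 hj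
    have hYj_eq : expectedTotal (hardInstance a₂ b₀ none h0.le h1) L obs hobs F T
      (pairIndicator (a₂, j)) = Y j := by rw [hY]
    rw [← hX, hYj_eq] at hchange
    have hhalf : 1 / 2 * (T : ℝ) ≤ 3 / 4 * T - X - 8 * T * (u / 6) ^ 2 * Y j := by
      have := mul_le_mul_of_nonneg_left hkl hTpos.le
      linarith
    calc 1 / 100 * (T * u) ≤ u / 6 * (1 / 2 * T) := by nlinarith
      _ ≤ _ := mul_le_mul_of_nonneg_left (hhalf.trans hchange) h0.le

end Regret

end StackelbergGame

end

open StackelbergGame in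
theorem theorem3 :
    ∃ c : ℝ, 0 < c ∧
      ∀ (A B : Type*) [Fintype A] [Fintype B] [MeasurableSpace A] [MeasurableSingletonClass A]
        [MeasurableSpace B] [MeasurableSingletonClass B],
        2 ≤ Fintype.card A → 2 ≤ Fintype.card B →
        ∀ T : ℕ, Fintype.card B ≤ T →
          -- strongly decentralized games: the leader does not see the follower's actions
          (∀ (L : LeaderAlg (A × ℝ) A) (F : FollowerAlg A B),
            ∃ I : GameInstance A B, ∀ γ : ℝ, 0 < γ → γ ≤ 1 →
              c * ((T : ℝ) ^ (2 / 3 : ℝ) * (Fintype.card B : ℝ) ^ (1 / 3 : ℝ)) ≤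
                max (leaderRegret γ I L strongObs measurable_strongObs F T)
                  (followerRegret γ I L strongObs measurable_strongObs F T)) ∧
          -- weakly decentralized games: the leader sees the follower's actions
          (∀ (L : LeaderAlg ((A × B) × ℝ) A) (F : FollowerAlg A B),
            ∃ I : GameInstance A B, ∀ γ : ℝ, 0 < γ → γ ≤ 1 →
              c * ((T : ℝ) ^ (2 / 3 : ℝ) * (Fintype.card B : ℝ) ^ (1 / 3 : ℝ)) ≤
                max (leaderRegret γ I L weakObs measurable_weakObs F T)
                  (followerRegret γ I L weakObs measurable_weakObs F T)) := by
  refine ⟨1 / 100, by norm_num, fun A B _ _ _ _ _ _ hA hB T hT => ?_⟩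
  obtain ⟨a₁, a₂, ha⟩ := Fintype.one_lt_card_iff.mp hA
  exact ⟨fun L F => exists_instance_regret_ge L strongObs measurable_strongObs F T ha hB hT,
    fun L F => exists_instance_regret_ge L weakObs measurable_weakObs F T ha hB hT⟩
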